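/- Terms and formulas of linear integer arithmetic (LIA) are given by the grammar $t ::= x \mid c \mid c\cdot t \mid t_1+t_2$ and $F ::= t_1\le t_2 \mid (c\mid t) \mid F_1\wedge F_2 \mid F_1\vee F_2 \mid \neg F \mid \exists x.\,F \mid \forall x.\,F$, where $x$ is a variable and $c\in\mathbb{Z}$; they are interpreted over the standard model of the integers (quantifiers range over $\mathbb{Z}$). For a formula $F$ with free variables among $x_1,\dots,x_n$ and $w\in\mathbb{Q}^n$, say that $F(w)$ holds if $w\in\mathbb{Z}^n$ and the valuation $x_i\mapsto w_i$ satisfies $F$. A matrix $A\in\mathbb{Q}^{n\times n}$ has integer spectrum if every complex root of its characteristic polynomial is an integer. Theorem. Let $G$ be an LIA formula with free variables among $x_1,\dots,x_n$ and let $A\in\mathbb{Q}^{n\times n}$ be a matrix with integer spectrum. Then there is a periodic sequence $H_0,H_1,H_2,\dots$ of LIA formulas with free variables among $x_1,\dots,x_n$ (i.e. there is $p\ge 1$ with $H_{k+p}=H_k$ for all $k\in\mathbb{N}$) such that for every integral initial state $x_0\in\mathbb{Z}^n$ there is $K\in\mathbb{N}$ such that for all $k>K$: $G(A^k x_0)$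 holds if and only if $H_k(x_0)$ holds. -/

import Mathlib

namespace LIA

/-- Terms of linear integer arithmetic over the variables `x₀, …, xₙ₋₁`:
`t ::= x | c | c · t | t₁ + t₂` with integer constants `c`. -/
inductive Term (n : ℕ) : Type where
  | var (i : Fin n) : Term n
  | const (c : ℤ) : Term n
  | smul (c : ℤ) (t : Term n) : Term n
  | add (t₁ t₂ : Term n) : Term n

/-- Formulas of linear integer arithmetic whose free variables are among `x₀, …, xₙ₋₁`:
`F ::= t₁ ≤ t₂ | (c ∣ t) | F₁ ∧ F₂ | F₁ ∨ F₂ | ¬ F | ∃ x. F | ∀ x. F`.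
In the body of a quantifier, variable `0` is the bound variable and variable `i + 1` is the
variable that is called `i` outside. -/
inductive Formula : ℕ → Type where
  | le {n : ℕ} (t₁ t₂ : Term n) : Formula n
  | dvd {n : ℕ} (c : ℤ) (t : Term n) : Formula n
  | and {n : ℕ} (F₁ F₂ : Formula n) : Formula n
  | or {n : ℕ} (F₁ F₂ : Formula n) : Formula n
  | not {n : ℕ} (F : Formula n) : Formula n
  | ex {n : ℕ} (F : Formula (n + 1)) : Formula n
  | all {n : ℕ} (F : Formula (n + 1)) : Formula n

/-- The value of a term under an integer valuation. -/
def Term.eval {n : ℕ} (v : Fin n → ℤ) : Term n → ℤ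
  | .var i => v i
  | .const c => c
  | .smul c t => c * t.eval v
  | .add t₁ t₂ => t₁.eval v + t₂.eval v

/-- `F.Sat v`: the valuation `v` satisfies `F` over the standard model of the integers
(quantifiers range over `ℤ`). -/
def Formula.Sat : {n : ℕ} → Formula n → (Fin n → ℤ) → Prop
  | _, .le t₁ t₂, v => t₁.eval v ≤ t₂.eval v
  | _, .dvd c t, v => c ∣ t.eval v
  | _, .and F₁ F₂, v => F₁.Sat v ∧ F₂.Sat v
  | _, .or F₁ F₂, v => F₁.Sat v ∨ F₂.Sat v
  | _, .not F, v => ¬ F.Sat v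
  | _, .ex F, v => ∃ a : ℤ, F.Sat (Fin.cons a v)
  | _, .all F, v => ∀ a : ℤ, F.Sat (Fin.cons a v)

/-- `F.HoldsAt w`: the formula `F` holds at the rational state `w`, i.e. `w` maps every variable
to an integer, and the resulting integer valuation satisfies `F`. -/
def Formula.HoldsAt {n : ℕ} (F : Formula n) (w : Fin n → ℚ) : Prop :=
  ∃ v : Fin n → ℤ, (∀ i, w i = (v i : ℚ)) ∧ F.Sat v

end LIA

/-- A rational square matrix has integer spectrum if every complex root of its characteristic
polynomial is an integer. -/
def HasIntegerSpectrum {n : ℕ} (A : Matrix (Fin n) (Fin n) ℚ) : Prop :=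
  ∀ μ : ℂ, Polynomial.aeval μ A.charpoly = 0 → ∃ m : ℤ, μ = (m : ℂ)

/-! Quantifier elimination (`Formula.exists_isQF_holdsAt`) turns `G` into a Boolean combination of
atoms `ℓ(w) ≤ 0` and `ℓ(w) ∈ ℤ` with `ℓ` rational affine, so it suffices to follow one atom along an
orbit. By Cayley–Hamilton and the integer spectrum (`HasIntegerSpectrum.isExpPoly_pow`), for large
`k` the value `ℓ(A ^ k v)` is a finite sum of terms `μ ^ k * k.choose j * ℓ'(v)` with `μ` a nonzero
integer and `ℓ'` affine.

Integrality: `μ ^ k * k.choose j` is ultimately periodic modulo any `D`, so on a residue class of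
`k` the atom is equivalent to integrality of one fixed form (`exists_period_affEval`).

Sign: for `k` of fixed parity, terms with equal `|μ|` and `j` merge, and the first nonzero
coefficient in order of decreasing growth decides. Which coefficient this is depends on `v` in a
quantifier-free way (`exists_isQF_sum_nonpos`); only the threshold for `k` is not uniform in `v`.

Both conclusions have the form `EventuallyQF`, which is stable under Boolean operations, and
clearing denominators returns to formulas. -/

namespace LIA

/-! ### Rational affine forms and their values at integer points -/

/-- Evaluation of rational affine forms `(c, d)`, i.e. `c ⬝ w + d`, at a rational point `w`,
as a linear map in the form. -/
def affEval {n : ℕ} (w : Fin n → ℚ) : ((Fin n → ℚ) × ℚ) →ₗ[ℚ] ℚ where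
  toFun a := a.1 ⬝ᵥ w + a.2
  map_add' a b := by simp only [Prod.fst_add, Prod.snd_add, add_dotProduct]; ring
  map_smul' c a := by
    simp only [Prod.smul_fst, Prod.smul_snd, smul_dotProduct, smul_eq_mul, RingHom.id_apply]; ring

theorem affEval_apply {n : ℕ} (w : Fin n → ℚ) (a : (Fin n → ℚ) × ℚ) :
    affEval w a = a.1 ⬝ᵥ w + a.2 := rfl

theorem affEval_const {n : ℕ} (w : Fin n → ℚ) (d : ℚ) : affEval w (0, d) = d := by
  simp [affEval_apply]

theorem affEval_single {n : ℕ} (w : Fin n → ℚ) (i : Fin n) :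
    affEval w (Pi.single i 1, 0) = w i := by
  simp [affEval_apply]

theorem affEval_cons {n : ℕ} (x : ℚ) (w : Fin n → ℚ) (a : (Fin (n + 1) → ℚ) × ℚ) :
    affEval (Fin.cons x w) a = a.1 0 * x + affEval w (Fin.tail a.1, a.2) := by
  simp only [affEval_apply, dotProduct, Fin.sum_univ_succ, Fin.cons_zero, Fin.cons_succ, Fin.tail]
  ring

/-- The inclusion of integer vectors into rational vectors. -/
def toRat {n : ℕ} (v : Fin n → ℤ) : Fin n → ℚ := fun i => (v i : ℚ)

theorem toRat_cons {n : ℕ} (x : ℤ) (v : Fin n → ℤ) :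
    toRat (Fin.cons x v : Fin (n + 1) → ℤ) = Fin.cons (x : ℚ) (toRat v) := by
  funext i
  refine Fin.cases ?_ (fun i => ?_) i <;> simp [toRat]

theorem Term.exists_affEval {n : ℕ} (t : Term n) :
    ∃ a, ∀ v : Fin n → ℤ, (t.eval v : ℚ) = affEval (toRat v) a := by
  induction t with
  | var i => exact ⟨(Pi.single i 1, 0), fun v => by simp [affEval_single, toRat, Term.eval]⟩
  | const c => exact ⟨(0, c), fun v => by simp [affEval_const, Term.eval]⟩
  | smul c t ih =>
    obtain ⟨a, ha⟩ := ih
    exact ⟨(c : ℚ) • a, fun v => by simp [Term.eval, ha]⟩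
  | add s t ihs iht =>
    obtain ⟨a, ha⟩ := ihs
    obtain ⟨b, hb⟩ := iht
    exact ⟨a + b, fun v => by simp [Term.eval, ha, hb]⟩

theorem exists_term_sum {n : ℕ} (c : Fin n → ℤ) (d : ℤ) :
    ∃ t : Term n, ∀ v, t.eval v = ∑ i, c i * v i + d := by
  have h : ∀ s : Finset (Fin n), ∃ t : Term n, ∀ v, t.eval v = ∑ i ∈ s, c i * v i + d := by
    intro s
    induction s using Finset.induction_on with
    | empty => exact ⟨.const d, fun v => by simp [Term.eval]⟩
    | insert i s hi ih =>
      obtain ⟨t, ht⟩ := ih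
      exact ⟨.add (.smul (c i) (.var i)) t, fun v => by
        simp [Term.eval, ht, Finset.sum_insert hi, add_assoc]⟩
  exact h Finset.univ

theorem exists_nat_mul_eq_int (q : ℚ) (D : ℕ) (h : q.den ∣ D) : ∃ z : ℤ, (D : ℚ) * q = z := by
  obtain ⟨e, rfl⟩ := h
  refine ⟨e * q.num, ?_⟩
  have := Rat.den_mul_eq_num q
  push_cast
  rw [← this]
  ring

/-- Affine forms take values of bounded denominator at integer points. -/
theorem exists_den {n : ℕ} (a : (Fin n → ℚ) × ℚ) :
    ∃ D : ℕ, 0 < D ∧ ∃ t : Term n, ∀ v : Fin n → ℤ,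
      (D : ℚ) * affEval (toRat v) a = (t.eval v : ℚ) := by
  set D : ℕ := (∏ i, (a.1 i).den) * a.2.den with hD
  have h1 : ∀ i, ∃ z : ℤ, (D : ℚ) * a.1 i = z := fun i =>
    exists_nat_mul_eq_int _ _ ((Finset.dvd_prod_of_mem _ (Finset.mem_univ i)).mul_right _)
  obtain ⟨d, hd⟩ : ∃ z : ℤ, (D : ℚ) * a.2 = z := exists_nat_mul_eq_int _ _ (Dvd.intro_left _ rfl)
  choose c hc using h1
  obtain ⟨t, ht⟩ := exists_term_sum c d
  refine ⟨D, ?_, t, fun v => ?_⟩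
  · exact Nat.mul_pos (Finset.prod_pos fun i _ => (a.1 i).den_pos) a.2.den_pos
  · rw [ht, affEval_apply, mul_add, hd]
    push_cast
    simp only [dotProduct, Finset.mul_sum, toRat, ← hc, mul_assoc]

/-! ### Quantifier-free predicates and Cooper-style elimination -/

/-- Quantifier-free predicates on rational vectors: Boolean combinations of inequalities between
rational affine forms and integrality conditions on them. -/
inductive IsQF {n : ℕ} : ((Fin n → ℚ) → Prop) → Prop where
  | le (a : (Fin n → ℚ) × ℚ) : IsQF fun w => affEval w a ≤ 0
  | int (a : (Fin n → ℚ) × ℚ) : IsQF fun w => ∃ z : ℤ, affEval w a = z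
  | and {P Q : (Fin n → ℚ) → Prop} (hP : IsQF P) (hQ : IsQF Q) : IsQF fun w => P w ∧ Q w
  | or {P Q : (Fin n → ℚ) → Prop} (hP : IsQF P) (hQ : IsQF Q) : IsQF fun w => P w ∨ Q w
  | not {P : (Fin n → ℚ) → Prop} (hP : IsQF P) : IsQF fun w => ¬ P w

namespace IsQF

variable {n : ℕ}

theorem false : IsQF fun _ : Fin n → ℚ => False := by
  simpa [affEval_const, not_le.2 (zero_lt_one' ℚ)] using IsQF.le ((0, 1) : (Fin n → ℚ) × ℚ)

theorem exists_mem {ι : Type*} (s : Finset ι) {P : ι → (Fin n → ℚ) → Prop}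
    (h : ∀ i ∈ s, IsQF (P i)) : IsQF fun w => ∃ i ∈ s, P i w := by
  classical
  induction s using Finset.induction_on with
  | empty => simpa using IsQF.false
  | insert i s hi ih =>
    simpa [or_and_right, exists_or] using
      (h i (by simp)).or (ih fun j hj => h j (by simp [hj]))

theorem forall_mem {ι : Type*} (s : Finset ι) {P : ι → (Fin n → ℚ) → Prop}
    (h : ∀ i ∈ s, IsQF (P i)) : IsQF fun w => ∀ i ∈ s, P i w := by
  simpa using (exists_mem s fun i hi => (h i hi).not).not

/-- Substitution of an affine form for the variable `0`. -/
theorem subst {Q : (Fin (n + 1) → ℚ) → Prop} (hQ : IsQF Q) (b : (Fin n → ℚ) × ℚ) :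
    IsQF fun w => Q (Fin.cons (affEval w b) w) := by
  have key : ∀ a : (Fin (n + 1) → ℚ) × ℚ, ∀ w, affEval (Fin.cons (affEval w b) w) a =
      affEval w (a.1 0 • b + (Fin.tail a.1, a.2)) := by
    intro a w
    rw [affEval_cons, map_add, map_smul, smul_eq_mul]
  induction hQ with
  | le a => simpa only [key] using IsQF.le _
  | int a => simpa only [key] using IsQF.int _
  | and _ _ h₁ h₂ => exact h₁.and h₂
  | or _ _ h₁ h₂ => exact h₁.or h₂
  | not _ h => exact h.not

/-- In the variable `0`, a quantifier-free predicate is periodic away from finitely many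
breakpoints that are affine in the remaining variables. -/
theorem exists_breakpoints {Q : (Fin (n + 1) → ℚ) → Prop} (hQ : IsQF Q) :
    ∃ L : ℕ, 0 < L ∧ ∃ B : Finset ((Fin n → ℚ) × ℚ), ∀ M : ℕ, L ∣ M → ∀ (w : Fin n → ℚ) (x : ℤ),
      (∀ b ∈ B, ¬ ((x : ℚ) ≤ affEval w b ∧ affEval w b ≤ ((x + M : ℤ) : ℚ))) →
      (Q (Fin.cons (x : ℚ) w) ↔ Q (Fin.cons ((x + M : ℤ) : ℚ) w)) := by
  classical
  induction hQ with
  | le a =>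
    by_cases ha : a.1 0 = 0
    · exact ⟨1, one_pos, ∅, fun M _ w x _ => by simp [affEval_cons, ha]⟩
    -- The breakpoint is the root of the form in the variable `0`: the sign can only change across
    -- it.
    · refine ⟨1, one_pos, {-((a.1 0)⁻¹ • (Fin.tail a.1, a.2))}, fun M _ w x h => ?_⟩
      simp only [Finset.mem_singleton, forall_eq, map_neg, map_smul, smul_eq_mul] at h
      simp only [affEval_cons]
      set t := affEval w (Fin.tail a.1, a.2)
      set b := -((a.1 0)⁻¹ * t) with hb
      have ht : t = - (a.1 0 * b) := by rw [hb]; field_simp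
      have hM : (0 : ℚ) ≤ M := by positivity
      rw [ht]
      push_cast at h ⊢
      rw [not_and_or, not_le, not_le] at h
      rcases lt_or_gt_of_ne ha with h0 | h0
      · rcases h with h | h
        · constructor <;> intro _ <;> nlinarith
        · constructor <;> intro _ <;> nlinarith
      · rcases h with h | h
        · constructor <;> intro _ <;> nlinarith
        · constructor <;> intro _ <;> nlinarith
  | int a =>
    -- A shift by a multiple of the denominator of the leading coefficient changes the value by an
    -- integer, so there is no breakpoint.
    refine ⟨(a.1 0).den, (a.1 0).den_pos, ∅, fun M hM w x _ => ?_⟩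
    obtain ⟨e, he⟩ := exists_nat_mul_eq_int _ _ hM
    simp only [affEval_cons]
    have : a.1 0 * ((x + M : ℤ) : ℚ) = a.1 0 * x + e := by
      rw [← he]; push_cast; ring
    rw [this]
    constructor
    · rintro ⟨z, hz⟩
      exact ⟨z + e, by push_cast; rw [← hz]; ring⟩
    · rintro ⟨z, hz⟩
      exact ⟨z - e, by push_cast; rw [← hz]; ring⟩
  | and _ _ h₁ h₂ =>
    obtain ⟨L₁, hL₁, B₁, h₁⟩ := h₁
    obtain ⟨L₂, hL₂, B₂, h₂⟩ := h₂
    -- Allowing every multiple `M` of the period lets both hypotheses be used with the same shift.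
    refine ⟨L₁ * L₂, Nat.mul_pos hL₁ hL₂, B₁ ∪ B₂, fun M hM w x h => and_congr ?_ ?_⟩
    · exact h₁ M (dvd_of_mul_right_dvd hM) w x fun b hb => h b (by simp [hb])
    · exact h₂ M (dvd_of_mul_left_dvd hM) w x fun b hb => h b (by simp [hb])
  | or _ _ h₁ h₂ =>
    obtain ⟨L₁, hL₁, B₁, h₁⟩ := h₁
    obtain ⟨L₂, hL₂, B₂, h₂⟩ := h₂
    refine ⟨L₁ * L₂, Nat.mul_pos hL₁ hL₂, B₁ ∪ B₂, fun M hM w x h => or_congr ?_ ?_⟩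
    · exact h₁ M (dvd_of_mul_right_dvd hM) w x fun b hb => h b (by simp [hb])
    · exact h₂ M (dvd_of_mul_left_dvd hM) w x fun b hb => h b (by simp [hb])
  | not _ h =>
    obtain ⟨L, hL, B, h⟩ := h
    exact ⟨L, hL, B, fun M hM w x hx => not_congr (h M hM w x hx)⟩

end IsQF

/-- A predicate on `ℤ` that has period `L` away from breakpoints is witnessed near a breakpoint. -/
theorem exists_near_breakpoint {P : ℤ → Prop} {L : ℕ} (hL : 0 < L) {B : Set ℚ} {b₀ : ℚ}
    (hb₀ : b₀ ∈ B)
    (hP : ∀ x : ℤ, (∀ b ∈ B, ¬ ((x : ℚ) ≤ b ∧ b ≤ ((x + L : ℤ) : ℚ))) → (P x ↔ P (x + L)))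
    {x : ℤ} (hx : P x) : ∃ y : ℤ, P y ∧ ∃ b ∈ B, |(y : ℚ) - b| ≤ L := by
  have hL' : (0 : ℚ) < L := by exact_mod_cast hL
  have hL1 : (1 : ℚ) ≤ L := by exact_mod_cast hL
  obtain ⟨N, hN⟩ : ∃ N : ℕ, |(x : ℚ) - b₀| ≤ N := exists_nat_ge _
  induction N generalizing x with
  | zero => exact ⟨x, hx, b₀, hb₀, hN.trans (by simp)⟩
  | succ N ih =>
    by_cases hnear : |(x : ℚ) - b₀| ≤ L
    · exact ⟨x, hx, b₀, hb₀, hnear⟩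
    by_contra! hcon
    have hxb : ∀ b ∈ B, (L : ℚ) < |(x : ℚ) - b| := hcon x hx
    rw [not_le, lt_abs] at hnear
    push_cast at hN
    rw [abs_le] at hN
    -- Every breakpoint is farther than `L` from `x`, so a step of `L` towards `b₀` meets none and
    -- preserves `P`; since `1 ≤ L`, the distance to `b₀` becomes at most `N`.
    rcases hnear with h | h
    · have hstep : P (x - L) := by
        refine (hP (x - L) fun b hb hb' => ?_).2 (by simpa using hx)
        have := hxb b hb
        rw [lt_abs] at this
        push_cast at hb'
        rcases this with h | h <;> linarith [hb'.1, hb'.2]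
      obtain ⟨y, hy, b, hb, hyb⟩ := ih hstep (by
        push_cast; rw [abs_le]; constructor <;> linarith [hN.1, hN.2])
      exact absurd hyb (not_le.2 (hcon y hy b hb))
    · have hstep : P (x + L) := by
        refine (hP x fun b hb hb' => ?_).1 hx
        have := hxb b hb
        rw [lt_abs] at this
        push_cast at hb'
        rcases this with h | h <;> linarith [hb'.1, hb'.2]
      obtain ⟨y, hy, b, hb, hyb⟩ := ih hstep (by
        push_cast; rw [abs_le]; constructor <;> linarith [hN.1, hN.2])
      exact absurd hyb (not_le.2 (hcon y hy b hb))

/-- Elimination of one existential quantifier over `ℤ`. -/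
theorem IsQF.exists_int {n : ℕ} {Q : (Fin (n + 1) → ℚ) → Prop} (hQ : IsQF Q) :
    ∃ R : (Fin n → ℚ) → Prop, IsQF R ∧
      ∀ v : Fin n → ℤ, (∃ x : ℤ, Q (Fin.cons (x : ℚ) (toRat v))) ↔ R (toRat v) := by
  classical
  obtain ⟨L, hL, B, hB⟩ := hQ.exists_breakpoints
  choose D hD t ht using fun b : (Fin n → ℚ) × ℚ => exists_den b
  -- The extra breakpoint `0` makes the set nonempty. At integer points `D b * b` is an integer, so
  -- an integer within `L` of `b` is `b + j / D b` with `|j| ≤ L * D b`: finitely many affine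
  -- candidates.
  refine ⟨fun w => ∃ b ∈ insert 0 B, ∃ j ∈ Finset.Icc (-(L * D b) : ℤ) (L * D b),
    (∃ z : ℤ, affEval w (b + (0, (j : ℚ) / D b)) = z) ∧
      Q (Fin.cons (affEval w (b + (0, (j : ℚ) / D b))) w), ?_, fun v => ⟨?_, ?_⟩⟩
  · exact exists_mem _ fun b _ => exists_mem _ fun j _ => (IsQF.int _).and (hQ.subst _)
  · rintro ⟨x, hx⟩
    obtain ⟨y, hy, _, ⟨b, hb, rfl⟩, hyb⟩ := exists_near_breakpoint
      (P := fun x : ℤ => Q (Fin.cons (x : ℚ) (toRat v))) (L := L) hL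
      (B := (fun b => affEval (toRat v) b) '' (insert 0 B : Finset ((Fin n → ℚ) × ℚ)))
      (Set.mem_image_of_mem _ (by simp : (0 : (Fin n → ℚ) × ℚ) ∈ _))
      (fun x hx => hB L dvd_rfl (toRat v) x fun b hb =>
        hx _ (Set.mem_image_of_mem _ (by simp [hb]))) hx
    have hDb : (0 : ℚ) < D b := by exact_mod_cast hD b
    have hval : affEval (toRat v) (b + (0, ((D b * y - (t b).eval v : ℤ) : ℚ) / D b)) = y := by
      rw [map_add, affEval_const]
      push_cast
      rw [← ht]
      field_simp
      ring
    refine ⟨b, by simpa using hb, D b * y - (t b).eval v, ?_, ⟨y, hval⟩, ?_⟩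
    · rw [Finset.mem_Icc, ← abs_le]
      have h1 : ((|(D b : ℤ) * y - (t b).eval v| : ℤ) : ℚ) ≤ ((L * D b : ℤ) : ℚ) := by
        push_cast
        rw [← ht, ← mul_sub, abs_mul, abs_of_pos hDb, mul_comm]
        exact mul_le_mul_of_nonneg_right hyb hDb.le
      exact_mod_cast h1
    · rw [hval]
      exact hy
  · rintro ⟨b, -, j, -, ⟨z, hz⟩, h⟩
    exact ⟨z, by rwa [hz] at h⟩

/-- Quantifier elimination for linear integer arithmetic. -/
theorem Formula.exists_isQF {n : ℕ} (F : Formula n) :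
    ∃ Q : (Fin n → ℚ) → Prop, IsQF Q ∧ ∀ v : Fin n → ℤ, F.Sat v ↔ Q (toRat v) := by
  induction F with
  | le s t =>
    obtain ⟨a, ha⟩ := s.exists_affEval
    obtain ⟨b, hb⟩ := t.exists_affEval
    refine ⟨_, IsQF.le (a - b), fun v => ?_⟩
    rw [map_sub, ← ha, ← hb, sub_nonpos, Int.cast_le, Formula.Sat]
  | dvd c t =>
    obtain ⟨a, ha⟩ := t.exists_affEval
    -- Divisibility by `0` means vanishing, whereas integrality of `(c : ℚ)⁻¹ • a` would be vacuous
    -- there because `0⁻¹ = 0`.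
    by_cases hc : c = 0
    · refine ⟨_, (IsQF.le a).and (IsQF.le (-a)), fun v => ?_⟩
      rw [map_neg, ← ha, Formula.Sat, hc, zero_dvd_iff, neg_nonpos, ← le_antisymm_iff]
      exact_mod_cast Iff.rfl
    · refine ⟨_, IsQF.int ((c : ℚ)⁻¹ • a), fun v => ?_⟩
      have hc' : (c : ℚ) ≠ 0 := by exact_mod_cast hc
      rw [map_smul, ← ha, Formula.Sat, smul_eq_mul]
      refine exists_congr fun z => ?_
      rw [inv_mul_eq_iff_eq_mul₀ hc']
      exact_mod_cast Iff.rfl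
  | and _ _ h₁ h₂ =>
    obtain ⟨P, hP, h₁⟩ := h₁
    obtain ⟨Q, hQ, h₂⟩ := h₂
    exact ⟨_, hP.and hQ, fun v => and_congr (h₁ v) (h₂ v)⟩
  | or _ _ h₁ h₂ =>
    obtain ⟨P, hP, h₁⟩ := h₁
    obtain ⟨Q, hQ, h₂⟩ := h₂
    exact ⟨_, hP.or hQ, fun v => or_congr (h₁ v) (h₂ v)⟩
  | not _ h =>
    obtain ⟨P, hP, h⟩ := h
    exact ⟨_, hP.not, fun v => not_congr (h v)⟩
  | ex _ h =>
    obtain ⟨P, hP, h⟩ := h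
    obtain ⟨R, hR, hPR⟩ := hP.exists_int
    refine ⟨R, hR, fun v => ?_⟩
    simp only [Formula.Sat, h, toRat_cons, hPR]
  | all _ h =>
    obtain ⟨P, hP, h⟩ := h
    obtain ⟨R, hR, hPR⟩ := hP.not.exists_int
    refine ⟨_, hR.not, fun v => ?_⟩
    simp only [Formula.Sat, h, toRat_cons, ← hPR, not_exists, not_not]

/-- Elimination is only valid at integer points, but orbits of `A` may leave `ℤ^n`; adding
integrality of all coordinates makes the equivalence hold at every rational point. -/
theorem Formula.exists_isQF_holdsAt {n : ℕ} (F : Formula n) :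
    ∃ Q : (Fin n → ℚ) → Prop, IsQF Q ∧ ∀ w, F.HoldsAt w ↔ Q w := by
  obtain ⟨Q, hQ, h⟩ := F.exists_isQF
  refine ⟨_, (IsQF.forall_mem Finset.univ
    fun i _ => IsQF.int ((Pi.single i 1, 0) : (Fin n → ℚ) × ℚ)).and hQ, fun w => ⟨?_, ?_⟩⟩
  · rintro ⟨v, hv, hF⟩
    obtain rfl : w = toRat v := funext hv
    exact ⟨fun i _ => ⟨v i, affEval_single _ i⟩, (h v).1 hF⟩
  · rintro ⟨hw, hF⟩
    simp only [affEval_single] at hw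
    choose v hv using fun i => hw i (Finset.mem_univ i)
    obtain rfl : w = toRat v := funext hv
    exact ⟨v, hv, (h v).2 hF⟩

end LIA

/-! ### Exponential polynomials and matrix powers -/

section ExponentialPolynomials

variable {M N : Type*} [AddCommGroup M] [Module ℚ M] [AddCommGroup N] [Module ℚ N]

/-- Sequences that eventually agree with a sum of sequences `k ↦ μ ^ k * k.choose j • m` with
nonzero integers `μ`. -/
inductive IsExpPoly : (ℕ → M) → Prop where
  | single (μ : ℤ) (hμ : μ ≠ 0) (j : ℕ) (m : M) :
      IsExpPoly fun k => ((μ : ℚ) ^ k * (k.choose j : ℚ)) • m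
  | add {f g : ℕ → M} (hf : IsExpPoly f) (hg : IsExpPoly g) : IsExpPoly fun k => f k + g k
  | congr {f g : ℕ → M} (hf : IsExpPoly f) (h : f =ᶠ[Filter.atTop] g) : IsExpPoly g

namespace IsExpPoly

theorem map {f : ℕ → M} (hf : IsExpPoly f) (φ : M →ₗ[ℚ] N) : IsExpPoly fun k => φ (f k) := by
  induction hf with
  | single μ hμ j m => simpa only [map_smul] using IsExpPoly.single μ hμ j (φ m)
  | add _ _ h₁ h₂ => simpa only [map_add] using h₁.add h₂
  | congr _ h ih => exact ih.congr (h.mono fun k hk => congrArg φ hk)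

theorem smul {f : ℕ → M} (hf : IsExpPoly f) (c : ℚ) : IsExpPoly fun k => c • f k :=
  hf.map (LinearMap.lsmul ℚ M c)

theorem const (m : M) : IsExpPoly fun _ => m := by
  simpa using IsExpPoly.single 1 one_ne_zero 0 m

/-- Pascal's rule solves the inhomogeneous recurrence. In the resonant case `μ = l` the index rises
to `j + 1`; otherwise `(μ - l)⁻¹` times the term itself works up to a term of index one lower, which
induction removes. -/
theorem exists_shift_sub_single (l : ℤ) (μ : ℤ) (hμ : μ ≠ 0) (j : ℕ) (m : M) :
    ∃ h : ℕ → M, IsExpPoly h ∧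
      ∀ k, h (k + 1) - (l : ℚ) • h k = ((μ : ℚ) ^ k * (k.choose j : ℚ)) • m := by
  have hμ' : (μ : ℚ) ≠ 0 := by exact_mod_cast hμ
  by_cases hl : μ = l
  · subst hl
    refine ⟨_, (IsExpPoly.single μ hμ (j + 1) m).smul (μ : ℚ)⁻¹, fun k => ?_⟩
    rw [smul_smul, smul_smul, smul_smul, ← sub_smul, Nat.choose_succ_succ, pow_succ]
    congr 1
    push_cast
    field_simp
    ring
  · have hsub : (μ : ℚ) - l ≠ 0 := sub_ne_zero.2 (by exact_mod_cast hl)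
    induction j with
    | zero =>
      refine ⟨_, (IsExpPoly.single μ hμ 0 m).smul ((μ : ℚ) - l)⁻¹, fun k => ?_⟩
      rw [smul_smul, smul_smul, smul_smul, ← sub_smul, pow_succ]
      congr 1
      simp only [Nat.choose_zero_right]
      field_simp
    | succ j ih =>
      obtain ⟨h, hh, hk⟩ := ih
      refine ⟨_, ((IsExpPoly.single μ hμ (j + 1) m).add (hh.smul (-(μ : ℚ)))).smul
        ((μ : ℚ) - l)⁻¹, fun k => ?_⟩
      have h1 : h (k + 1) = (l : ℚ) • h k + ((μ : ℚ) ^ k * (k.choose j : ℚ)) • m := by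
        rw [← hk]; abel
      rw [h1, Nat.choose_succ_succ, pow_succ]
      push_cast
      match_scalars <;> field_simp <;> ring

theorem exists_shift_sub {g : ℕ → M} (hg : IsExpPoly g) (l : ℤ) :
    ∃ h : ℕ → M, IsExpPoly h ∧ ∀ᶠ k in Filter.atTop, h (k + 1) - (l : ℚ) • h k = g k := by
  induction hg with
  | single μ hμ j m =>
    obtain ⟨h, hh, hk⟩ := exists_shift_sub_single l μ hμ j m
    exact ⟨h, hh, Filter.Eventually.of_forall hk⟩
  | add _ _ h₁ h₂ =>
    obtain ⟨h₁, hh₁, hk₁⟩ := h₁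
    obtain ⟨h₂, hh₂, hk₂⟩ := h₂
    refine ⟨_, hh₁.add hh₂, ?_⟩
    filter_upwards [hk₁, hk₂] with k e₁ e₂
    rw [← e₁, ← e₂, smul_add]
    abel
  | congr _ h ih =>
    obtain ⟨f, hf, hk⟩ := ih
    exact ⟨f, hf, by filter_upwards [hk, h] with k e₁ e₂ using e₁.trans e₂⟩

/-- A geometric sequence from `K` on. For `l = 0` it is eventually zero, which is why bases can be
kept nonzero and equality is only required eventually. -/
theorem of_shift_eq {f : ℕ → M} (l : ℤ)
    (h : ∀ᶠ k in Filter.atTop, f (k + 1) = (l : ℚ) • f k) : IsExpPoly f := by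
  obtain ⟨K, hK⟩ := Filter.eventually_atTop.1 h
  by_cases hl : l = 0
  · refine (IsExpPoly.const (0 : M)).congr ?_
    filter_upwards [Filter.eventually_ge_atTop (K + 1)] with k hk
    obtain ⟨k, rfl⟩ : ∃ i, k = i + 1 := ⟨k - 1, by omega⟩
    rw [hK k (by omega), hl]
    simp
  · have hl' : (l : ℚ) ≠ 0 := by exact_mod_cast hl
    refine (IsExpPoly.single l hl 0 (((l : ℚ) ^ K)⁻¹ • f K)).congr ?_
    filter_upwards [Filter.eventually_ge_atTop K] with k hk
    induction k, hk using Nat.le_induction with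
    | base =>
      rw [smul_smul, Nat.choose_zero_right, Nat.cast_one, mul_one,
        mul_inv_cancel₀ (pow_ne_zero _ hl'), one_smul]
    | succ k hk ih =>
      rw [hK k hk, ← ih, smul_smul (l : ℚ), pow_succ]
      simp only [Nat.choose_zero_right, Nat.cast_one, mul_one, mul_comm]

/-- Subtracting a particular solution leaves a solution of the homogeneous recurrence. -/
theorem of_shift_sub {f : ℕ → M} (l : ℤ)
    (hf : IsExpPoly fun k => f (k + 1) - (l : ℚ) • f k) : IsExpPoly f := by
  obtain ⟨h, hh, hk⟩ := hf.exists_shift_sub l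
  have h1 : IsExpPoly fun k => f k - h k := of_shift_eq l (by
    filter_upwards [hk] with k e
    rw [smul_sub, sub_eq_sub_iff_sub_eq_sub, ← e])
  exact (h1.add hh).congr (Filter.Eventually.of_forall fun k => sub_add_cancel _ _)

theorem exists_finsupp {f : ℕ → M} (hf : IsExpPoly f) :
    ∃ c : (ℤ × ℕ) →₀ M, (∀ x ∈ c.support, x.1 ≠ 0) ∧ ∀ᶠ k in Filter.atTop,
      f k = c.sum fun x m => ((x.1 : ℚ) ^ k * (k.choose x.2 : ℚ)) • m := by
  classical
  induction hf with
  | single μ hμ j m =>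
    refine ⟨Finsupp.single (μ, j) m, fun x hx => ?_, Filter.Eventually.of_forall fun k => ?_⟩
    · rw [Finset.mem_singleton.1 (Finsupp.support_single_subset hx)]
      exact hμ
    · simp
  | add _ _ h₁ h₂ =>
    obtain ⟨c₁, h₁, hk₁⟩ := h₁
    obtain ⟨c₂, h₂, hk₂⟩ := h₂
    refine ⟨c₁ + c₂, fun x hx => ?_, ?_⟩
    · rcases Finset.mem_union.1 (Finsupp.support_add hx) with h | h
      exacts [h₁ x h, h₂ x h]
    · filter_upwards [hk₁, hk₂] with k e₁ e₂
      rw [Finsupp.sum_add_index' (fun _ => smul_zero _) (fun _ _ _ => smul_add _ _ _), e₁, e₂]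
  | congr _ h ih =>
    obtain ⟨c, hc, hk⟩ := ih
    exact ⟨c, hc, by filter_upwards [hk, h] with k e₁ e₂ using e₂.symm.trans e₁⟩

end IsExpPoly

/-- With `f k = A ^ k * B`, the difference `f (k + 1) - l • f k` is `A ^ k * ((A - l) * B)`. One
linear factor is thus absorbed into `B`, which therefore has to vary in the induction. -/
theorem isExpPoly_pow_mul {R : Type*} [Ring R] [Algebra ℚ R] (A : R) (s : Multiset ℤ) (B : R)
    (h : Polynomial.aeval A (s.map fun l : ℤ => (Polynomial.X - Polynomial.C (l : ℚ))).prod * B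
      = 0) : IsExpPoly fun k => A ^ k * B := by
  induction s using Multiset.induction_on generalizing B with
  | empty =>
    obtain rfl : B = 0 := by simpa using h
    simpa using IsExpPoly.const (0 : R)
  | cons l s ih =>
    refine IsExpPoly.of_shift_sub l ?_
    rw [Multiset.map_cons, Multiset.prod_cons, mul_comm, map_mul, mul_assoc] at h
    refine (ih _ h).congr (Filter.Eventually.of_forall fun k => ?_)
    simp only [map_sub, Polynomial.aeval_X, Polynomial.aeval_C, sub_mul, mul_sub, pow_succ,
      ← Algebra.smul_def, mul_assoc, Algebra.mul_smul_comm]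

end ExponentialPolynomials

theorem HasIntegerSpectrum.exists_charpoly_eq {n : ℕ} {A : Matrix (Fin n) (Fin n) ℚ}
    (hA : HasIntegerSpectrum A) : ∃ s : Multiset ℤ,
      A.charpoly = (s.map fun l : ℤ => (Polynomial.X - Polynomial.C (l : ℚ))).prod := by
  set p := A.charpoly.map (algebraMap ℚ ℂ) with hp
  have hmon : p.Monic := A.charpoly_monic.map _
  have hroots : ∀ μ ∈ p.roots, ∃ m : ℤ, (m : ℂ) = μ := fun μ hμ => by
    obtain ⟨m, hm⟩ := hA μ (by
      rw [Polynomial.aeval_def, ← Polynomial.eval_map]; exact (Polynomial.mem_roots'.1 hμ).2)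
    exact ⟨m, hm.symm⟩
  choose! g hg using hroots
  obtain ⟨s, hs⟩ : ∃ s : Multiset ℤ, s.map (fun m : ℤ => (m : ℂ)) = p.roots := by
    refine ⟨p.roots.map g, ?_⟩
    rw [Multiset.map_map]
    exact (Multiset.map_congr rfl hg).trans (Multiset.map_id _)
  refine ⟨s, Polynomial.map_injective (algebraMap ℚ ℂ) (algebraMap ℚ ℂ).injective ?_⟩
  rw [← hp, (IsAlgClosed.splits p).eq_prod_roots_of_monic hmon, ← hs, Polynomial.map_multiset_prod,
    Multiset.map_map, Multiset.map_map]
  simp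

theorem HasIntegerSpectrum.isExpPoly_pow {n : ℕ} {A : Matrix (Fin n) (Fin n) ℚ}
    (hA : HasIntegerSpectrum A) : IsExpPoly fun k => A ^ k := by
  obtain ⟨s, hs⟩ := hA.exists_charpoly_eq
  simpa using isExpPoly_pow_mul A s 1 (by rw [← hs, A.aeval_self_charpoly, zero_mul])

section

open Asymptotics Filter

/-! ### Ultimately periodic sequences -/

/-- Pigeonhole: an orbit in a finite set repeats a state, and is periodic from there on. -/
theorem exists_period_of_finite {X : Type*} [Finite X] (x : ℕ → X) (Φ : X → X)
    (h : ∀ k, x (k + 1) = Φ (x k)) :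
    ∃ p : ℕ, 0 < p ∧ ∃ K : ℕ, ∀ k ≥ K, ∀ l ≥ K, k ≡ l [MOD p] → x k = x l := by
  obtain ⟨a, b, hab, hx⟩ : ∃ a b, a < b ∧ x a = x b := by
    obtain ⟨a, b, hab, hx⟩ := Finite.exists_ne_map_eq_of_infinite x
    rcases lt_or_gt_of_ne hab with h | h
    exacts [⟨a, b, h, hx⟩, ⟨b, a, h, hx.symm⟩]
  obtain ⟨p, rfl⟩ := Nat.exists_eq_add_of_lt hab
  have hper : ∀ k ≥ a, x (k + (p + 1)) = x k := by
    intro k hk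
    induction k, hk using Nat.le_induction with
    | base => exact hx.symm
    | succ k _ ih => rw [add_right_comm, h, ih, h]
  have hmul : ∀ k ≥ a, ∀ q, x (k + (p + 1) * q) = x k := by
    intro k hk q
    induction q with
    | zero => rfl
    | succ q ih => rw [mul_add_one, ← add_assoc, hper _ (by omega), ih]
  have hle : ∀ k ≥ a, ∀ l ≥ a, k ≤ l → k ≡ l [MOD p + 1] → x k = x l := by
    intro k hk l _ hkl hmod
    obtain ⟨q, hq⟩ := (Nat.modEq_iff_dvd' hkl).1 hmod
    rw [← hmul k hk q, ← hq, Nat.add_sub_cancel' hkl]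
  refine ⟨p + 1, p.succ_pos, a, fun k hk l hl hmod => ?_⟩
  rcases le_total k l with hkl | hkl
  exacts [hle k hk l hl hkl hmod, (hle l hl k hk hkl hmod.symm).symm]

/-- A single residue does not determine its successor, but by Pascal's rule the vector of residues
of `μ ^ k * k.choose i` for all `i ≤ j` does. -/
theorem exists_period_pow_mul_choose (μ : ℤ) (j D : ℕ) (hD : 0 < D) :
    ∃ p : ℕ, 0 < p ∧ ∃ K : ℕ, ∀ k ≥ K, ∀ l ≥ K, k ≡ l [MOD p] →
      ∃ z : ℤ, μ ^ k * (k.choose j : ℤ) - μ ^ l * (l.choose j : ℤ) = D * z := by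
  have : NeZero D := ⟨hD.ne'⟩
  obtain ⟨p, hp, K, h⟩ := exists_period_of_finite
    (fun k (i : Fin (j + 1)) => ((μ : ZMod D) ^ k * (k.choose i : ZMod D)))
    (fun c => Fin.cases ((μ : ZMod D) * c 0)
      fun i => (μ : ZMod D) * (c i.castSucc + c i.succ)) (fun k => by
      funext i
      refine Fin.cases ?_ (fun i => ?_) i
      · simp [pow_succ, mul_comm]
      · simp only [Fin.val_succ, Fin.cases_succ, Nat.choose_succ_succ, pow_succ, Fin.val_castSucc]
        push_cast
        ring)
  refine ⟨p, hp, K, fun k hk l hl hkl => ?_⟩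
  have := congrFun (h k hk l hl hkl) (Fin.last j)
  refine (ZMod.intCast_zmod_eq_zero_iff_dvd _ D).1 ?_
  push_cast
  simpa [sub_eq_zero] using this

namespace LIA

/-- Period and threshold are uniform in `v` because one denominator `D` serves all integer points.
-/
theorem exists_period_affEval {n : ℕ} {f : ℕ → (Fin n → ℚ) × ℚ} (hf : IsExpPoly f) :
    ∃ p : ℕ, 0 < p ∧ ∃ K : ℕ, ∀ k ≥ K, ∀ l ≥ K, k ≡ l [MOD p] →
      ∀ v : Fin n → ℤ, ∃ z : ℤ, affEval (toRat v) (f k) - affEval (toRat v) (f l) = z := by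
  induction hf with
  | single μ hμ j m =>
    obtain ⟨D, hD, t, ht⟩ := exists_den m
    obtain ⟨p, hp, K, h⟩ := exists_period_pow_mul_choose μ j D hD
    refine ⟨p, hp, K, fun k hk l hl hkl v => ?_⟩
    obtain ⟨z, hz⟩ := h k hk l hl hkl
    have hz' : (μ : ℚ) ^ k * (k.choose j : ℚ) - (μ : ℚ) ^ l * (l.choose j : ℚ) = D * z := by
      exact_mod_cast hz
    refine ⟨z * t.eval v, ?_⟩
    rw [← map_sub, ← sub_smul, map_smul, hz', smul_eq_mul, Int.cast_mul, ← ht]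
    ring
  | add _ _ h₁ h₂ =>
    obtain ⟨p₁, hp₁, K₁, h₁⟩ := h₁
    obtain ⟨p₂, hp₂, K₂, h₂⟩ := h₂
    refine ⟨p₁ * p₂, Nat.mul_pos hp₁ hp₂, max K₁ K₂, fun k hk l hl hkl v => ?_⟩
    obtain ⟨z₁, hz₁⟩ := h₁ k (le_of_max_le_left hk) l (le_of_max_le_left hl)
      (hkl.of_dvd (dvd_mul_right _ _)) v
    obtain ⟨z₂, hz₂⟩ := h₂ k (le_of_max_le_right hk) l (le_of_max_le_right hl)
      (hkl.of_dvd (dvd_mul_left _ _)) v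
    exact ⟨z₁ + z₂, by rw [Int.cast_add, ← hz₁, ← hz₂, map_add, map_add]; ring⟩
  | congr _ h ih =>
    obtain ⟨p, hp, K, ih⟩ := ih
    obtain ⟨K', hK'⟩ := eventually_atTop.1 h
    refine ⟨p, hp, max K K', fun k hk l hl hkl v => ?_⟩
    rw [← hK' k (le_of_max_le_right hk), ← hK' l (le_of_max_le_right hl)]
    exact ih k (le_of_max_le_left hk) l (le_of_max_le_left hl) hkl v

/-! ### Signs of exponential polynomials -/

/-- `k.choose j` has order `k ^ j`, so a larger base wins outright and, for equal bases, a larger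
index wins; hence the lexicographic order. -/
theorem isLittleO_pow_mul_choose {x y : ℕ ×ₗ ℕ} (h : x < y) :
    (fun k : ℕ => ((ofLex x).1 : ℝ) ^ k * (k.choose (ofLex x).2 : ℝ)) =o[atTop]
      fun k : ℕ => ((ofLex y).1 : ℝ) ^ k * (k.choose (ofLex y).2 : ℝ) := by
  rcases Prod.Lex.lt_iff.1 h with h | ⟨h, h'⟩
  · refine IsBigO.trans_isLittleO (g := fun k : ℕ =>
      (k : ℝ) ^ (ofLex x).2 * ((ofLex x).1 : ℝ) ^ k) ?_ (IsLittleO.trans_isBigO (g := fun k : ℕ =>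
        ((ofLex y).1 : ℝ) ^ k) ?_ ?_)
    · simp only [mul_comm (((ofLex x).1 : ℝ) ^ _)]
      exact (isTheta_choose _).1.mul (isBigO_refl _ _)
    · exact isLittleO_pow_const_mul_const_pow_const_pow_of_norm_lt _ (by simpa using h)
    · refine IsBigO.of_bound 1 ?_
      filter_upwards [eventually_ge_atTop (ofLex y).2] with k hk
      have h1 : (1 : ℝ) ≤ (k.choose (ofLex y).2 : ℝ) := by
        exact_mod_cast Nat.choose_pos hk
      rw [one_mul, norm_mul]
      refine le_mul_of_one_le_right (norm_nonneg _) ?_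
      rwa [Real.norm_of_nonneg (by positivity)]
  · rw [← h]
    refine (isBigO_refl _ _).mul_isLittleO ?_
    refine (isTheta_choose _).1.trans_isLittleO (IsLittleO.trans_isBigO ?_ (isTheta_choose _).2)
    exact (isLittleO_pow_pow_atTop_of_lt h').comp_tendsto tendsto_natCast_atTop_atTop

theorem eventually_dominant_neg {ι : Type*} (J : Finset ι) (e : ι → ℕ → ℝ) (x : ι)
    (ho : ∀ y ∈ J, e y =o[atTop] e x) (hpos : ∀ᶠ k in atTop, 0 < e x k) (a : ι → ℝ)
    (ha : a x < 0) : ∀ᶠ k in atTop, e x k * a x + ∑ y ∈ J, e y k * a y < 0 := by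
  have hsum : (fun k => ∑ y ∈ J, e y k * a y) =o[atTop] e x := by
    simpa only [Finset.sum_fn] using IsLittleO.sum (A := fun y k => e y k * a y)
      fun y hy => by simpa only [mul_comm] using (ho y hy).const_mul_left (a y)
  filter_upwards [hpos, hsum.def (half_pos (neg_pos.2 ha))] with k hk hb
  have := le_trans (le_abs_self _) hb
  rw [Real.norm_of_nonneg hk.le] at this
  nlinarith

theorem eventually_dominant_pos {ι : Type*} (J : Finset ι) (e : ι → ℕ → ℝ) (x : ι)
    (ho : ∀ y ∈ J, e y =o[atTop] e x) (hpos : ∀ᶠ k in atTop, 0 < e x k) (a : ι → ℝ)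
    (ha : 0 < a x) : ∀ᶠ k in atTop, 0 < e x k * a x + ∑ y ∈ J, e y k * a y := by
  filter_upwards [eventually_dominant_neg J e x ho hpos (fun y => - a y) (neg_neg_of_pos ha)]
    with k hk
  simp only [mul_neg, Finset.sum_neg_distrib] at hk
  linarith

/-- The eventual sign of a sum of exponential polynomials with positive bases depends on the
affine coefficients in a quantifier-free way. -/
theorem exists_isQF_sum_nonpos {n : ℕ} (J : Finset (ℕ ×ₗ ℕ)) (hJ : ∀ x ∈ J, 0 < (ofLex x).1)
    (a : ℕ ×ₗ ℕ → (Fin n → ℚ) × ℚ) :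
    ∃ R : (Fin n → ℚ) → Prop, IsQF R ∧ ∀ w, ∀ᶠ k : ℕ in atTop,
      (∑ x ∈ J, ((ofLex x).1 : ℚ) ^ k * (k.choose (ofLex x).2 : ℚ) * affEval w (a x) ≤ 0 ↔
        R w) := by
  induction J using Finset.induction_on_max with
  | empty => exact ⟨_, IsQF.false.not, fun w => by simp⟩
  | insert x J hlt ih =>
    obtain ⟨R, hR, h⟩ := ih fun y hy => hJ y (Finset.mem_insert_of_mem hy)
    have hx := hJ x (Finset.mem_insert_self _ _)
    have hnot : x ∉ J := fun hm => lt_irrefl _ (hlt x hm)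
    -- `x` grows fastest, so the sum is eventually `≤ 0` iff its coefficient is negative, or it
    -- vanishes and the remaining sum is eventually `≤ 0`. A positive coefficient fails both
    -- disjuncts.
    refine ⟨_, (IsQF.le (-a x)).not.or ((IsQF.le (a x)).and hR), fun w => ?_⟩
    set e : ℕ ×ₗ ℕ → ℕ → ℝ := fun x k => ((ofLex x).1 : ℝ) ^ k * (k.choose (ofLex x).2 : ℝ) with he
    have ho : ∀ y ∈ J, e y =o[atTop] e x := fun y hy =>
      isLittleO_pow_mul_choose (hlt y hy)
    have hpos : ∀ᶠ k in atTop, 0 < e x k := by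
      filter_upwards [eventually_ge_atTop (ofLex x).2] with k hk
      have := Nat.choose_pos hk
      simp only [he]
      positivity
    simp only [map_neg, neg_nonpos, not_le, Finset.sum_insert hnot]
    rcases lt_trichotomy (affEval w (a x)) 0 with hs | hs | hs
    · filter_upwards [eventually_dominant_neg J e x ho hpos (fun y => (affEval w (a y) : ℝ))
        (by exact_mod_cast hs)] with k hk
      simp only [hs, true_or, iff_true]
      simp only [he] at hk
      exact_mod_cast hk.le
    · filter_upwards [h w] with k hk
      simp [hs, hk]
    · filter_upwards [eventually_dominant_pos J e x ho hpos (fun y => (affEval w (a y) : ℝ))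
        (by exact_mod_cast hs)] with k hk
      simp only [hs.not_gt, hs.not_ge, false_and, or_self, iff_false, not_le]
      simp only [he] at hk
      exact_mod_cast hk

/-! ### Atoms along the orbit -/

/-- A family of predicates on integer vectors that is eventually, on each residue class of the
index, given by a quantifier-free predicate. -/
def EventuallyQF {n : ℕ} (T : ℕ → (Fin n → ℤ) → Prop) : Prop :=
  ∃ p : ℕ, 0 < p ∧ ∀ r : ℕ, ∃ R : (Fin n → ℚ) → Prop, IsQF R ∧
    ∀ v, ∀ᶠ k in atTop, k ≡ r [MOD p] → (T k v ↔ R (toRat v))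

namespace EventuallyQF

variable {n : ℕ} {S T : ℕ → (Fin n → ℤ) → Prop}

theorem not (hT : EventuallyQF T) : EventuallyQF fun k v => ¬ T k v := by
  obtain ⟨p, hp, h⟩ := hT
  refine ⟨p, hp, fun r => ?_⟩
  obtain ⟨R, hR, h⟩ := h r
  exact ⟨_, hR.not, fun v => (h v).mono fun k hk hr => not_congr (hk hr)⟩

theorem and (hS : EventuallyQF S) (hT : EventuallyQF T) :
    EventuallyQF fun k v => S k v ∧ T k v := by
  obtain ⟨p, hp, hS⟩ := hS
  obtain ⟨q, hq, hT⟩ := hT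
  refine ⟨p * q, Nat.mul_pos hp hq, fun r => ?_⟩
  obtain ⟨P, hP, hS⟩ := hS r
  obtain ⟨Q, hQ, hT⟩ := hT r
  refine ⟨_, hP.and hQ, fun v => ?_⟩
  filter_upwards [hS v, hT v] with k h₁ h₂ hr
  exact and_congr (h₁ (hr.of_dvd (dvd_mul_right _ _))) (h₂ (hr.of_dvd (dvd_mul_left _ _)))

theorem or (hS : EventuallyQF S) (hT : EventuallyQF T) :
    EventuallyQF fun k v => S k v ∨ T k v := by
  simpa only [not_and_or, not_not] using (hS.not.and hT.not).not

theorem int {f : ℕ → (Fin n → ℚ) × ℚ} (hf : IsExpPoly f) :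
    EventuallyQF fun k v => ∃ z : ℤ, affEval (toRat v) (f k) = z := by
  obtain ⟨p, hp, K, h⟩ := exists_period_affEval hf
  -- The index `r + p * K` is congruent to `r` and at least `K`, so it represents the class.
  refine ⟨p, hp, fun r => ⟨_, IsQF.int (f (r + p * K)), fun v => ?_⟩⟩
  filter_upwards [eventually_ge_atTop K] with k hk hkr
  obtain ⟨e, he⟩ := h k hk (r + p * K) (by nlinarith) (hkr.trans (by simp [Nat.ModEq])) v
  rw [sub_eq_iff_eq_add] at he
  rw [he]
  constructor
  · rintro ⟨z, hz⟩
    exact ⟨z - e, by push_cast; rw [← hz]; ring⟩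
  · rintro ⟨z, hz⟩
    exact ⟨z + e, by push_cast; rw [← hz]; ring⟩

/-- Bases `μ` and `-μ` have equal growth and may cancel, so terms are grouped by `(|μ|, j)`. Fixing
the parity of `k` turns `sign μ ^ k` into the constant `sign μ ^ r`, which goes into the
coefficient; hence the period `2`. -/
theorem nonpos {f : ℕ → (Fin n → ℚ) × ℚ} (hf : IsExpPoly f) :
    EventuallyQF fun k v => affEval (toRat v) (f k) ≤ 0 := by
  classical
  obtain ⟨c, hc, hk⟩ := hf.exists_finsupp
  refine ⟨2, two_pos, fun r => ?_⟩
  set g : ℤ × ℕ → ℕ ×ₗ ℕ := fun x => toLex (x.1.natAbs, x.2) with hg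
  obtain ⟨R, hR, h⟩ := exists_isQF_sum_nonpos (c.support.image g)
    (by
      intro y hy
      obtain ⟨x, hx, rfl⟩ := Finset.mem_image.1 hy
      exact Int.natAbs_pos.2 (hc x hx))
    (fun y => ∑ x ∈ c.support with g x = y, (x.1.sign : ℚ) ^ r • c x)
  refine ⟨R, hR, fun v => ?_⟩
  filter_upwards [h (toRat v), hk] with k h hk hr
  rw [← h, hk, Finsupp.sum, map_sum, ← Finset.sum_fiberwise_of_maps_to
    (fun x hx => Finset.mem_image_of_mem g hx)]
  refine iff_of_eq (congrArg (· ≤ 0) (Finset.sum_congr rfl fun y _ => ?_))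
  rw [map_sum, Finset.mul_sum]
  refine Finset.sum_congr rfl fun x hx => ?_
  obtain ⟨hxc, rfl⟩ := Finset.mem_filter.1 hx
  have hsign : (x.1.sign : ℚ) ^ k = (x.1.sign : ℚ) ^ r := by
    rcases Int.sign_trichotomy x.1 with h | h | h
    · simp [h]
    · exact absurd (Int.sign_eq_zero_iff_zero.1 h) (hc x hxc)
    · rw [h, Int.cast_neg, Int.cast_one, neg_one_pow_eq_pow_mod_two, hr,
        ← neg_one_pow_eq_pow_mod_two]
  have hpow : (x.1 : ℚ) ^ k = (x.1.sign : ℚ) ^ r * (x.1.natAbs : ℚ) ^ k := by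
    rw [← hsign, ← mul_pow]
    congr 1
    rw [← Int.cast_natCast, ← Int.cast_mul, Int.sign_mul_natAbs]
  simp only [hg, ofLex_toLex, map_smul, smul_eq_mul, hpow]
  ring

end EventuallyQF

/-- Pulling an affine form back along a matrix. -/
theorem affEval_mulVec {n : ℕ} (B : Matrix (Fin n) (Fin n) ℚ) (w : Fin n → ℚ)
    (a : (Fin n → ℚ) × ℚ) :
    affEval (B.mulVec w) a = affEval w (Matrix.vecMul a.1 B, a.2) := by
  simp only [affEval_apply, Matrix.dotProduct_mulVec]

theorem isExpPoly_vecMul_pow {n : ℕ} {A : Matrix (Fin n) (Fin n) ℚ} (hA : HasIntegerSpectrum A)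
    (a : (Fin n → ℚ) × ℚ) :
    IsExpPoly fun k => ((Matrix.vecMul a.1 (A ^ k), a.2) : (Fin n → ℚ) × ℚ) := by
  let φ : Matrix (Fin n) (Fin n) ℚ →ₗ[ℚ] (Fin n → ℚ) × ℚ :=
    { toFun := fun B => (Matrix.vecMul a.1 B, 0)
      map_add' := fun B C => by simp [Matrix.vecMul_add]
      map_smul' := fun c B => by simp [Matrix.vecMul_smul] }
  simpa [φ] using (hA.isExpPoly_pow.map φ).add (IsExpPoly.const (0, a.2))

theorem IsQF.eventuallyQF {n : ℕ} {A : Matrix (Fin n) (Fin n) ℚ} (hA : HasIntegerSpectrum A)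
    {Q : (Fin n → ℚ) → Prop} (hQ : IsQF Q) :
    EventuallyQF fun k v => Q ((A ^ k).mulVec (toRat v)) := by
  induction hQ with
  | le a => simpa only [affEval_mulVec] using EventuallyQF.nonpos (isExpPoly_vecMul_pow hA a)
  | int a => simpa only [affEval_mulVec] using EventuallyQF.int (isExpPoly_vecMul_pow hA a)
  | and _ _ h₁ h₂ => exact h₁.and h₂
  | or _ _ h₁ h₂ => exact h₁.or h₂
  | not _ h => exact h.not

/-! ### Return to formulas and the main theorem -/

/-- Quantifier-free predicates are expressible by formulas of linear integer arithmetic. -/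
theorem IsQF.exists_formula {n : ℕ} {Q : (Fin n → ℚ) → Prop} (hQ : IsQF Q) :
    ∃ F : Formula n, ∀ v : Fin n → ℤ, F.Sat v ↔ Q (toRat v) := by
  induction hQ with
  | le a =>
    obtain ⟨D, hD, t, ht⟩ := exists_den a
    refine ⟨.le t (.const 0), fun v => ?_⟩
    have hD' : (0 : ℚ) < D := by exact_mod_cast hD
    beta_reduce
    rw [← mul_le_mul_iff_right₀ hD', mul_zero, ht]
    simp only [Formula.Sat, Term.eval]
    exact_mod_cast Iff.rfl
  | int a =>
    obtain ⟨D, hD, t, ht⟩ := exists_den a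
    refine ⟨.dvd D t, fun v => ?_⟩
    have hD' : (D : ℚ) ≠ 0 := by exact_mod_cast hD.ne'
    refine exists_congr fun z => ?_
    rw [← mul_right_inj' hD', ht]
    exact_mod_cast Iff.rfl
  | and _ _ h₁ h₂ =>
    obtain ⟨F, hF⟩ := h₁
    obtain ⟨G, hG⟩ := h₂
    exact ⟨.and F G, fun v => and_congr (hF v) (hG v)⟩
  | or _ _ h₁ h₂ =>
    obtain ⟨F, hF⟩ := h₁
    obtain ⟨G, hG⟩ := h₂
    exact ⟨.or F G, fun v => or_congr (hF v) (hG v)⟩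
  | not _ h =>
    obtain ⟨F, hF⟩ := h
    exact ⟨.not F, fun v => not_congr (hF v)⟩

theorem Formula.holdsAt_toRat {n : ℕ} (F : Formula n) (v : Fin n → ℤ) :
    F.HoldsAt (toRat v) ↔ F.Sat v := by
  refine ⟨?_, fun h => ⟨v, fun _ => rfl, h⟩⟩
  rintro ⟨u, hu, h⟩
  obtain rfl : v = u := funext fun i => Int.cast_injective (hu i)
  exact h

end LIA

end

theorem mainTheorem5 {n : ℕ} (G : LIA.Formula n) (A : Matrix (Fin n) (Fin n) ℚ)
    (hA : HasIntegerSpectrum A) :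
    ∃ H : ℕ → LIA.Formula n,
      (∃ p : ℕ, 0 < p ∧ Function.Periodic H p) ∧
      ∀ x₀ : Fin n → ℚ, (∀ i, ∃ z : ℤ, x₀ i = (z : ℚ)) →
        ∃ K : ℕ, ∀ k : ℕ, K < k →
          (G.HoldsAt (Matrix.mulVec (A ^ k) x₀) ↔ (H k).HoldsAt x₀) := by
  obtain ⟨Q, hQ, hG⟩ := G.exists_isQF_holdsAt
  obtain ⟨p, hp, h⟩ := hQ.eventuallyQF hA
  choose R hR h using h
  choose F hF using fun r => (hR r).exists_formula
  refine ⟨fun k => F (k % p), ⟨p, hp, fun k => by simp⟩, fun x₀ hx₀ => ?_⟩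
  choose v hv using hx₀
  obtain rfl : x₀ = LIA.toRat v := funext hv
  -- The thresholds depend on `v` and on the class `r`; as there are only `p` classes, a common one
  -- exists for each `v`.
  have hall : ∀ᶠ k in Filter.atTop, ∀ r ∈ Finset.range p, k ≡ r [MOD p] →
      (Q ((A ^ k).mulVec (LIA.toRat v)) ↔ R r (LIA.toRat v)) :=
    (Filter.eventually_all_finset _).2 fun r _ => h r v
  obtain ⟨K, hK⟩ := Filter.eventually_atTop.1 hall
  refine ⟨K, fun k hk => ?_⟩
  rw [hG, LIA.Formula.holdsAt_toRat, hF]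
  exact hK k hk.le (k % p) (Finset.mem_range.2 (Nat.mod_lt _ hp)) (Nat.mod_modEq k p).symm
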